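/- All graphs are finite and simple. For a graph $G$ let $I(G;x)=\sum_{k=0}^{\alpha(G)}s_k(G)x^k$ be its independence polynomial, where $s_k(G)$ is the number of independent sets of size $k$ and $\alpha(G)$ is the independence number. A polynomial with coefficient sequence $(a_0,\dots,a_d)$, $d$ its degree, is unimodal if for some $p$ one has $a_0\le\cdots\le a_p\ge\cdots\ge a_d$, and log-concave if $a_i^2\ge a_{i-1}a_{i+1}$ for $1\le i\le d-1$. For $m,t\ge 1$ let $T_{m,t}$ (Galvin's tree) be the tree with a root $v$, children $w_1,\dots,w_m$ of $v$, and, for each $i\le m$ and $j\le t$, a path $w_i\,a_{i,j}\,b_{i,j}$ attached at $w_i$ through two new vertices $a_{i,j},b_{i,j}$. Let $T_{G,m,t}$ (the Bautista--Ramos tree) be the tree formed from $m$ disjoint copies of $T_{3,t}$ by joining their roots to a new vertex $v_0$ and adding one further leaf adjacent to $v_0$. Let \[ \begin{aligned} \mathcal F={}&\{T_{4,t}:5\le t\le 9\}\cup\{T_{5,t}:5\le t\le 8\}\cup\{T_{6,5},T_{6,6}\}\\ &\cup\{T_{G,2,t}:6\le t\le 8\}\cup\{T_{G,3,t}:6\le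 t\le 8\}. \end{aligned} \] **Theorem.** Every $T\in\mathcal F$ is a tree, and for every nonedge $e$ of $T$ (a pair of distinct nonadjacent vertices) the graph $T+e$ is unicyclic (connected with exactly one cycle) and its independence polynomial is unimodal but not log-concave. The total number of pairs $(T,e)$ with $T\in\mathcal F$ and $e$ a nonedge of $T$ is $66{,}303$. -/

import Mathlib

open Polynomial

/-- Number of independent sets of size `k` of a finite graph. -/
noncomputable def indepCount {V : Type*} (G : SimpleGraph V) (k : ℕ) : ℕ :=
  Set.ncard {s : Finset V | G.IsNIndepSet k s}

/-- The independence polynomial `∑_{k=0}^{α(G)} s_k(G) x^k` of a finite graph. -/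
noncomputable def indepPoly {V : Type*} (G : SimpleGraph V) : ℕ[X] :=
  ∑ k ∈ Finset.range (G.indepNum + 1), C (indepCount G k) * X ^ k

/-- The sequence `a 0, …, a d` rises to a peak and then falls (weakly). -/
def SeqUnimodal (a : ℕ → ℕ) (d : ℕ) : Prop :=
  ∃ p ≤ d, (∀ i, i < p → a i ≤ a (i + 1)) ∧ (∀ i, p ≤ i → i < d → a (i + 1) ≤ a i)

/-- The sequence `a 0, …, a d` satisfies `a (i-1) * a (i+1) ≤ a i ^ 2` for `1 ≤ i ≤ d - 1`. -/
def SeqLogConcave (a : ℕ → ℕ) (d : ℕ) : Prop :=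
  ∀ i, 1 ≤ i → i + 1 ≤ d → a (i - 1) * a (i + 1) ≤ a i ^ 2

/-- A polynomial is unimodal if its coefficient sequence, up to its degree, is. -/
def PolyUnimodal (p : ℕ[X]) : Prop := SeqUnimodal p.coeff p.natDegree

/-- A polynomial is log-concave if its coefficient sequence, up to its degree, is. -/
def PolyLogConcave (p : ℕ[X]) : Prop := SeqLogConcave p.coeff p.natDegree

/-- Connected, with exactly one cycle (cycles are identified with their edge sets). -/
def IsUnicyclic {V : Type*} (G : SimpleGraph V) : Prop :=
  G.Connected ∧ ∃! s : Set (Sym2 V), ∃ (v : V) (c : G.Walk v v), c.IsCycle ∧ {e | e ∈ c.edges} = s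

/-- The graph `G + e` obtained from `G` by adding the edge `e`. -/
def addEdge {V : Type*} (G : SimpleGraph V) (e : Sym2 V) : SimpleGraph V :=
  G ⊔ SimpleGraph.fromEdgeSet {e}

/-- Vertices of Galvin's tree `T_{m,t}`: the root `v`, its children `w_i`, and the vertices
`a_{i,j}`, `b_{i,j}` of the `j`-th `P_2`-arm `w_i a_{i,j} b_{i,j}` at `w_i`. -/
inductive GalvinVertex (m t : ℕ) : Type
  | root : GalvinVertex m t
  | child (i : Fin m) : GalvinVertex m t
  | mid (i : Fin m) (j : Fin t) : GalvinVertex m t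
  | tip (i : Fin m) (j : Fin t) : GalvinVertex m t

/-- The edges of `T_{m,t}`, directed away from the root. -/
inductive GalvinRel (m t : ℕ) : GalvinVertex m t → GalvinVertex m t → Prop
  | root_child (i : Fin m) : GalvinRel m t .root (.child i)
  | child_mid (i : Fin m) (j : Fin t) : GalvinRel m t (.child i) (.mid i j)
  | mid_tip (i : Fin m) (j : Fin t) : GalvinRel m t (.mid i j) (.tip i j)

/-- Galvin's tree `T_{m,t}`. -/
def galvinTree (m t : ℕ) : SimpleGraph (GalvinVertex m t) :=
  SimpleGraph.fromRel (GalvinRel m t)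

/-- Vertices of the Bautista--Ramos tree `T_{G,m,t}`: the root `v_0`, the extra leaf at `v_0`, and
the vertices of `m` disjoint copies of `T_{3,t}`. -/
inductive BRVertex (m t : ℕ) : Type
  | root : BRVertex m t
  | leaf : BRVertex m t
  | copy (i : Fin m) (x : GalvinVertex 3 t) : BRVertex m t

/-- The edges of `T_{G,m,t}`, directed away from the root. -/
inductive BRRel (m t : ℕ) : BRVertex m t → BRVertex m t → Prop
  | root_leaf : BRRel m t .root .leaf
  | root_copy (i : Fin m) : BRRel m t .root (.copy i .root)
  | copy_copy (i : Fin m) {x y : GalvinVertex 3 t} (h : GalvinRel 3 t x y) :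
      BRRel m t (.copy i x) (.copy i y)

/-- The Bautista--Ramos tree `T_{G,m,t}`. -/
def brTree (m t : ℕ) : SimpleGraph (BRVertex m t) :=
  SimpleGraph.fromRel (BRRel m t)

/-- The parameters `(m, t)` of the listed Galvin trees. -/
def galvinParams : Finset (ℕ × ℕ) :=
  ({4} ×ˢ Finset.Icc 5 9) ∪ ({5} ×ˢ Finset.Icc 5 8) ∪ {(6, 5), (6, 6)}

/-- The parameters `(m, t)` of the listed Bautista--Ramos trees. -/
def brParams : Finset (ℕ × ℕ) :=
  ({2} ×ˢ Finset.Icc 6 8) ∪ ({3} ×ˢ Finset.Icc 6 8)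

/-- `T` is a tree, and for every nonedge `e` of `T` the graph `T + e` is unicyclic with a unimodal
and non-log-concave independence polynomial. -/
def UniversalEnlargement {V : Type*} (T : SimpleGraph V) : Prop :=
  T.IsTree ∧ ∀ e ∈ Tᶜ.edgeSet,
    IsUnicyclic (addEdge T e) ∧
    PolyUnimodal (indepPoly (addEdge T e)) ∧
    ¬ PolyLogConcave (indepPoly (addEdge T e))

/-! A tree plus a nonedge is connected with as many edges as vertices, and this forces exactly one
cycle (`isUnicyclic_of_ncard_edgeSet`). The claims about coefficients rest on exact computation,
made small by three observations.

The independent sets of `T + uv` are those of `T` that do not contain both `u` and `v`. So I(T+uv)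
is I(T) minus the contribution of the sets containing both (`indepSum_addEdge`), and both terms are
weighted sums over the tree alone, where they factor over branches and arms (`indepSum_galvinTree`,
`indepSum_brTree`).

A polynomial whose coefficients lie below `B` is encoded by its value at `B`, the coefficients being
the base-`B` digits. Since s_k ≤ 2^|V|, any `B` > 2^|V| serves, and each graph becomes one natural
number to inspect (`unimodal_not_logConcave_of_digitCheck`).

Automorphisms permuting copies, branches and arms move any pair `u`, `v` into the first two of each.
At most 4·11 pairs per Galvin tree and 6·24 per Bautista-Ramos tree remain, and the untouched
branches enter only as powers of one common value (`galvinSum_eq_galvinSumOfUniform`,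
`brSum_eq_brSumOfUniform`). The kernel evaluates these cases. -/

namespace SimpleGraph

/-! ### Trees, unicyclic graphs and the number of nonedges. -/

variable {V : Type*}

/-- A connected finite graph with as many edges as vertices is unicyclic. -/
theorem Connected.isUnicyclic_of_ncard_edgeSet [Finite V] {G : SimpleGraph V} (hG : G.Connected)
    (hcard : G.edgeSet.ncard = Nat.card V) : IsUnicyclic G := by
  -- Every cycle consists of exactly the non-bridges, so all cycles share one edge set. Otherwise,
  -- deleting a non-bridge off the cycle `c` leaves a connected graph with |V| - 1 edges, a tree
  -- that still contains `c`.
  have key : ∀ (e : Sym2 V) (v : V) (c : G.Walk v v), c.IsCycle →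
      (e ∈ c.edges ↔ e ∈ G.edgeSet ∧ ¬ G.IsBridge e) := by
    intro e v c hc
    refine ⟨fun he => ⟨c.edges_subset_edgeSet he, fun hb => hb.notMem_edges_of_isCycle hc he⟩, ?_⟩
    rintro ⟨he, hb⟩
    by_contra hne
    induction e with | _ x y =>
    have htree : (G.deleteEdges {s(x, y)}).IsTree := by
      refine isTree_iff_connected_and_card.2 ⟨hG.connected_delete_edge_of_not_isBridge hb, ?_⟩
      rw [Nat.card_coe_set_eq, edgeSet_deleteEdges, Set.ncard_sdiff_singleton_add_one he, hcard]
    refine htree.isAcyclic (c.transfer _ fun e' he' => ?_) (hc.transfer _)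
    rw [edgeSet_deleteEdges]
    exact ⟨c.edges_subset_edgeSet he', fun h => hne (by rwa [Set.mem_singleton_iff.1 h] at he')⟩
  have hcyc : ¬ G.IsAcyclic := fun h => by
    have := (isTree_iff_connected_and_card.1 ⟨hG, h⟩).2
    rw [Nat.card_coe_set_eq] at this
    omega
  simp only [IsAcyclic, not_forall, not_not] at hcyc
  obtain ⟨v, c, hc⟩ := hcyc
  refine ⟨hG, {e | e ∈ G.edgeSet ∧ ¬ G.IsBridge e}, ⟨v, c, hc, ?_⟩, ?_⟩
  · ext e
    exact key e v c hc
  · rintro s ⟨v', c', hc', rfl⟩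
    ext e
    exact key e v' c' hc'

/-- Adding a nonedge to a finite tree gives a unicyclic graph. -/
theorem IsTree.isUnicyclic_addEdge [Finite V] {T : SimpleGraph V} (hT : T.IsTree) {e : Sym2 V}
    (he : e ∈ Tᶜ.edgeSet) : IsUnicyclic (addEdge T e) := by
  have hne : e ∉ T.edgeSet := by
    induction e with | _ x y => exact fun h => ((T.compl_adj x y).1 he).2 h
  have hd : ¬ e.IsDiag := Tᶜ.not_isDiag_of_mem_edgeSet he
  have hconn : (addEdge T e).Connected := hT.connected.mono le_sup_left
  refine hconn.isUnicyclic_of_ncard_edgeSet ?_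
  have hset : (addEdge T e).edgeSet = insert e T.edgeSet := by
    rw [addEdge, edgeSet_sup, edgeSet_fromEdgeSet, Set.union_comm, ← Set.singleton_union]
    congr 1
    ext f
    simp only [Set.mem_sdiff, Set.mem_singleton_iff]
    exact ⟨fun h => h.1, fun h => ⟨h, h ▸ hd⟩⟩
  rw [hset, Set.ncard_insert_of_notMem hne, ← (isTree_iff_connected_and_card.1 hT).2,
    Nat.card_coe_set_eq]

/-- A finite graph whose edges join each vertex other than `r` to its parent is a tree. -/
theorem isTree_of_parent [Finite V] {G : SimpleGraph V} (r : V) (parent : V → V) (depth : V → ℕ)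
    (hdepth : ∀ x, x ≠ r → depth (parent x) < depth x) (hparent : ∀ x, x ≠ r → G.Adj x (parent x))
    (hadj : ∀ x y, G.Adj x y → (x ≠ r ∧ parent x = y) ∨ (y ≠ r ∧ parent y = x)) : G.IsTree := by
  have hreach : ∀ n x, depth x < n → G.Reachable x r := by
    intro n
    induction n with
    | zero => intro x hx; omega
    | succ n ih =>
      intro x hx
      by_cases hxr : x = r
      · rw [hxr]
      · exact (hparent x hxr).reachable.trans (ih _ (by have := hdepth x hxr; omega))
  have hconn : G.Connected :=
    { preconnected := fun x y => (hreach _ x (Nat.lt_succ_self _)).trans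
        (hreach _ y (Nat.lt_succ_self _)).symm
      nonempty := ⟨r⟩ }
  refine isTree_iff_connected_and_card.2 ⟨hconn, le_antisymm ?_ hconn.card_vert_le_card_edgeSet_add_one⟩
  -- Each edge is charged to its child end, so there are at most |V| - 1 edges.
  have hsub : G.edgeSet ⊆ (fun x => s(x, parent x)) '' {r}ᶜ := by
    intro e he
    induction e with | _ x y =>
    rcases hadj x y he with ⟨hx, rfl⟩ | ⟨hy, rfl⟩
    · exact ⟨x, hx, rfl⟩
    · exact ⟨y, hy, Sym2.eq_swap⟩
  have h1 := (Set.ncard_le_ncard hsub (Set.toFinite _)).trans (Set.ncard_image_le (Set.toFinite _))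
  have h2 := Set.ncard_add_ncard_compl ({r} : Set V)
  rw [Set.ncard_singleton] at h2
  rw [Nat.card_coe_set_eq]
  omega

/-- A tree on `n + 1` vertices has `(n + 1).choose 2 - n` nonedges. -/
theorem IsTree.ncard_compl_edgeSet [Finite V] {T : SimpleGraph V} (hT : T.IsTree) {n : ℕ}
    (hn : Nat.card V = n + 1) : Tᶜ.edgeSet.ncard = (n + 1).choose 2 - n := by
  classical
  have := Fintype.ofFinite V
  have htree := (isTree_iff_connected_and_card.1 hT).2
  rw [Nat.card_coe_set_eq, hn] at htree
  have hunion : T.edgeSet ∪ Tᶜ.edgeSet = (⊤ : SimpleGraph V).edgeSet := by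
    rw [← edgeSet_sup, sup_compl_eq_top]
  have hdisj : Disjoint T.edgeSet Tᶜ.edgeSet := by
    rw [disjoint_edgeSet]; exact disjoint_compl_right
  have htop : (⊤ : SimpleGraph V).edgeSet.ncard = (n + 1).choose 2 := by
    rw [← hn, Nat.card_eq_fintype_card, ← card_edgeFinset_top_eq_card_choose_two,
      ← coe_edgeFinset, Set.ncard_coe_finset]
  have := Set.ncard_union_eq hdisj
  rw [hunion, htop] at this
  omega

end SimpleGraph

/-! ### Coefficients of the independence polynomial. -/

section IndependencePolynomial

variable {V : Type*}

theorem coeff_indepPoly [Finite V] (G : SimpleGraph V) (k : ℕ) :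
    (indepPoly G).coeff k = indepCount G k := by
  have := Fintype.ofFinite V
  simp only [indepPoly, finsetSum_coeff, coeff_C_mul, coeff_X_pow, mul_ite, mul_one, mul_zero,
    Finset.sum_ite_eq, Finset.mem_range]
  split_ifs with h
  · rfl
  · refine (Set.ncard_eq_zero (Set.toFinite _)).2 (Set.eq_empty_iff_forall_notMem.2 fun s hs => h ?_) |>.symm
    have h1 := hs.isIndepSet.card_le_indepNum
    rw [hs.card_eq] at h1
    omega

theorem indepCount_eq_zero [Fintype V] (G : SimpleGraph V) {k : ℕ} (hk : Fintype.card V < k) :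
    indepCount G k = 0 := by
  refine (Set.ncard_eq_zero (Set.toFinite _)).2 (Set.eq_empty_iff_forall_notMem.2 fun s hs => ?_)
  have h1 := hs.card_eq
  have h2 := Finset.card_le_univ s
  omega

theorem indepCount_le [Fintype V] (G : SimpleGraph V) (k : ℕ) :
    indepCount G k ≤ 2 ^ Fintype.card V := by
  rw [← Fintype.card_finset, ← Nat.card_eq_fintype_card]
  exact Set.ncard_le_card _

/-- Lets a peak be found without knowing the degree: a peak beyond `d` is cut back to `d`. -/
theorem SeqUnimodal.of_peak {a : ℕ → ℕ} (d p : ℕ) (hup : ∀ i, i < p → a i ≤ a (i + 1))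
    (hdown : ∀ i, p ≤ i → a (i + 1) ≤ a i) : SeqUnimodal a d :=
  ⟨min p d, min_le_right _ _, fun i hi => hup i (lt_of_lt_of_le hi (min_le_left _ _)),
    fun i hi hid => hdown i (by omega)⟩

/-- The strict inequality makes the coefficient at `i + 2` nonzero, so the violation automatically
lies within the degree. -/
theorem not_polyLogConcave {p : ℕ[X]} {i : ℕ}
    (hi : p.coeff (i + 1) ^ 2 < p.coeff i * p.coeff (i + 2)) : ¬ PolyLogConcave p := by
  intro h
  have hne : p.coeff (i + 2) ≠ 0 := fun h0 => by simp [h0] at hi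
  have := h (i + 1) (by omega) (le_natDegree_of_ne_zero hne)
  exact absurd hi (not_lt.2 this)

end IndependencePolynomial

/-! ### Reading coefficients as digits, and Boolean tests on digit lists. -/

section DigitChecks

/-- The `n` lowest digits of `N` in base `B`, starting with the units digit. -/
def lowDigits (B : ℕ) : ℕ → ℕ → List ℕ
  | 0, _ => []
  | n + 1, N => N % B :: lowDigits B n (N / B)

theorem getD_lowDigits (B : ℕ) {n k : ℕ} (hk : k < n) (N : ℕ) :
    (lowDigits B n N).getD k 0 = N / B ^ k % B := by
  induction n generalizing k N with
  | zero => omega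
  | succ n ih =>
    cases k with
    | zero => simp [lowDigits]
    | succ k =>
      rw [lowDigits, List.getD_cons_succ, ih (by omega), Nat.div_div_eq_div_mul, pow_succ']

theorem length_lowDigits (B n N : ℕ) : (lowDigits B n N).length = n := by
  induction n generalizing N with
  | zero => rfl
  | succ n ih => simp [lowDigits, ih]

/-- Coefficients below `B` cause no carries; the induction strips the units digit and shifts `a`. -/
theorem sum_div_pow_mod {B : ℕ} {a : ℕ → ℕ} (ha : ∀ k, a k < B) {n k : ℕ} (hk : k < n) :
    (∑ i ∈ Finset.range n, a i * B ^ i) / B ^ k % B = a k := by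
  have hB : 0 < B := (Nat.zero_le _).trans_lt (ha 0)
  induction n generalizing a k with
  | zero => omega
  | succ n ih =>
    have hsum : ∑ i ∈ Finset.range (n + 1), a i * B ^ i
        = a 0 + B * ∑ i ∈ Finset.range n, a (i + 1) * B ^ i := by
      rw [Finset.sum_range_succ', Finset.mul_sum, add_comm]
      congr 1
      · simp
      · exact Finset.sum_congr rfl fun i _ => by ring
    rw [hsum]
    cases k with
    | zero => simp [Nat.mod_eq_of_lt (ha 0)]
    | succ k =>
      rw [pow_succ', ← Nat.div_div_eq_div_mul, Nat.add_mul_div_left _ _ hB,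
        Nat.div_eq_of_lt (ha 0), zero_add]
      exact ih (fun k => ha (k + 1)) (by omega)

/-- The list is weakly decreasing. -/
def isDescending : List ℕ → Bool
  | a :: b :: l => Nat.ble b a && isDescending (b :: l)
  | _ => true

/-- The list weakly increases and then weakly decreases. -/
def isUnimodal : List ℕ → Bool
  | a :: b :: l => if Nat.ble a b then isUnimodal (b :: l) else isDescending (a :: b :: l)
  | _ => true

/-- Some three consecutive entries of the list violate log-concavity. -/
def violatesLogConcavity : List ℕ → Bool
  | a :: b :: c :: l => Nat.blt (b * b) (a * c) || violatesLogConcavity (b :: c :: l)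
  | _ => false

theorem getD_succ_le_of_isDescending : ∀ {l : List ℕ}, isDescending l = true →
    ∀ i, l.getD (i + 1) 0 ≤ l.getD i 0
  | [], _, _ => by simp
  | [a], _, i => by simp
  | a :: b :: l, h, i => by
    simp only [isDescending, Bool.and_eq_true, Nat.ble_eq] at h
    cases i with
    | zero => simpa using h.1
    | succ i => simpa using getD_succ_le_of_isDescending h.2 i

theorem exists_peak_of_isUnimodal : ∀ {l : List ℕ}, isUnimodal l = true →
    ∃ p, (∀ i, i < p → l.getD i 0 ≤ l.getD (i + 1) 0) ∧
      ∀ i, p ≤ i → l.getD (i + 1) 0 ≤ l.getD i 0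
  | [], _ => ⟨0, by simp, by simp⟩
  | [a], _ => ⟨0, by simp, by simp⟩
  | a :: b :: l, h => by
    rw [isUnimodal] at h
    split_ifs at h with hab
    · obtain ⟨p, hup, hdown⟩ := exists_peak_of_isUnimodal h
      refine ⟨p + 1, fun i hi => ?_, fun i hi => ?_⟩
      · cases i with
        | zero => simpa using Nat.le_of_ble_eq_true hab
        | succ i => simpa using hup i (by omega)
      · cases i with
        | zero => omega
        | succ i => simpa using hdown i (by omega)
    · exact ⟨0, by simp, fun i _ => getD_succ_le_of_isDescending h i⟩

theorem exists_of_violatesLogConcavity : ∀ {l : List ℕ}, violatesLogConcavity l = true →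
    ∃ i, l.getD (i + 1) 0 ^ 2 < l.getD i 0 * l.getD (i + 2) 0
  | [], h => by simp [violatesLogConcavity] at h
  | [a], h => by simp [violatesLogConcavity] at h
  | [a, b], h => by simp [violatesLogConcavity] at h
  | a :: b :: c :: l, h => by
    rw [violatesLogConcavity, Bool.or_eq_true, Nat.blt_eq] at h
    rcases h with h | h
    · exact ⟨0, by simpa [sq] using h⟩
    · obtain ⟨i, hi⟩ := exists_of_violatesLogConcavity h
      exact ⟨i + 1, by simpa using hi⟩

/-- The digits of `N` in base `B`, of which there are at most `n`, form a unimodal sequence that is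
not log-concave; a violation of log-concavity is sought among the eight leading digits. -/
def digitCheck (B n N : ℕ) : Bool :=
  Nat.blt N (B ^ n) && (isUnimodal (lowDigits B n N) &&
    violatesLogConcavity ((lowDigits B n N).drop (n - 8)))

end DigitChecks

/-! ### Weighted sums over independent sets, and the effect of adding an edge. -/

section WeightedSums

open scoped Classical in
/-- The sum over the independent sets of `G`, given by their indicator functions, of the product of
the weights `w x (f x)`. -/
noncomputable def indepSum {V : Type*} [Fintype V] (G : SimpleGraph V) (w : V → Bool → ℕ) : ℕ :=
  ∑ f : V → Bool, if ∀ x y, G.Adj x y → ¬ (f x = true ∧ f y = true) then ∏ x, w x (f x) else 0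

/-- The weight `B` for each chosen vertex. -/
def uniformWeight {V : Type*} (B : ℕ) (_ : V) (b : Bool) : ℕ := bif b then B else 1

/-- The weight `B` for each chosen vertex, where `u` and `v` must be chosen. -/
def forcedWeight {V : Type*} [DecidableEq V] (B : ℕ) (u v x : V) (b : Bool) : ℕ :=
  bif b then B else if x = u then 0 else if x = v then 0 else 1

variable {V : Type*} [Fintype V]

/-- On a set containing both `u` and `v` the forced weight agrees with the uniform one; on any other
set it has a zero factor. Stated additively, the identity avoids truncated subtraction. Nonadjacency
is not needed: for adjacent `u`, `v` the forced sum is zero. -/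
theorem indepSum_addEdge [DecidableEq V] (T : SimpleGraph V) (B : ℕ) {u v : V} (huv : u ≠ v) :
    indepSum (addEdge T s(u, v)) (uniformWeight B) + indepSum T (forcedWeight B u v)
      = indepSum T (uniformWeight B) := by
  classical
  have hadd : ∀ f : V → Bool,
      (∀ x y, (addEdge T s(u, v)).Adj x y → ¬ (f x = true ∧ f y = true)) ↔
        (∀ x y, T.Adj x y → ¬ (f x = true ∧ f y = true)) ∧ ¬ (f u = true ∧ f v = true) := by
    intro f
    simp only [addEdge, SimpleGraph.sup_adj, SimpleGraph.fromEdgeSet_adj, Set.mem_singleton_iff,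
      Sym2.eq_iff]
    constructor
    · exact fun h => ⟨fun x y hxy => h x y (Or.inl hxy), h u v (Or.inr ⟨Or.inl ⟨rfl, rfl⟩, huv⟩)⟩
    · rintro ⟨h1, h2⟩ x y (h | ⟨⟨rfl, rfl⟩ | ⟨rfl, rfl⟩, _⟩)
      · exact h1 x y h
      · exact h2
      · exact fun h => h2 h.symm
  rw [indepSum, indepSum, indepSum, ← Finset.sum_add_distrib]
  refine Finset.sum_congr rfl fun f _ => ?_
  simp only [hadd]
  by_cases hT : ∀ x y, T.Adj x y → ¬ (f x = true ∧ f y = true)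
  · by_cases hf : f u = true ∧ f v = true
    · rw [if_neg (fun h => h.2 hf), if_pos hT, if_pos hT, zero_add]
      refine Finset.prod_congr rfl fun x _ => ?_
      by_cases hx : f x = true
      · simp [forcedWeight, uniformWeight, hx]
      · have h1 : x ≠ u := fun h => hx (h ▸ hf.1)
        have h2 : x ≠ v := fun h => hx (h ▸ hf.2)
        simp [forcedWeight, uniformWeight, h1, h2]
    · rw [if_pos ⟨hT, hf⟩, if_pos hT, if_pos hT, Nat.add_eq_left]
      rcases not_and_or.1 hf with h | h
      · exact Finset.prod_eq_zero (Finset.mem_univ u) (by simp [forcedWeight, h])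
      · exact Finset.prod_eq_zero (Finset.mem_univ v) (by simp [forcedWeight, h])
  · rw [if_neg (fun h => hT h.1), if_neg hT, if_neg hT]

theorem indepSum_uniformWeight (G : SimpleGraph V) (B : ℕ) :
    indepSum G (uniformWeight B)
      = ∑ k ∈ Finset.range (Fintype.card V + 1), indepCount G k * B ^ k := by
  classical
  have hsum : indepSum G (uniformWeight B)
      = ∑ s : Finset V, if G.IsIndepSet (s : Set V) then B ^ s.card else 0 := by
    refine (Fintype.sum_bijective (fun (s : Finset V) (x : V) => decide (x ∈ s)) ?_ _ _ ?_).symm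
    · constructor
      · intro s s' h
        ext x
        simpa using congrFun h x
      · intro f
        exact ⟨Finset.univ.filter fun x => f x = true, by ext x; simp⟩
    · intro s
      have hiff : G.IsIndepSet (s : Set V) ↔
          ∀ x y, G.Adj x y → ¬ (decide (x ∈ s) = true ∧ decide (y ∈ s) = true) := by
        simp only [SimpleGraph.IsIndepSet, Set.Pairwise, decide_eq_true_eq]
        exact ⟨fun h x y hxy hs => h hs.1 hs.2 hxy.ne hxy, fun h x hx y hy _ hxy => h x y hxy ⟨hx, hy⟩⟩
      simp only [hiff]
      congr 1
      simp [uniformWeight, Bool.cond_decide, Finset.prod_ite_mem]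
  rw [hsum, ← Finset.sum_fiberwise_of_maps_to (t := Finset.range (Fintype.card V + 1))
    (g := Finset.card) fun s _ => Finset.mem_range.2 (Nat.lt_succ_of_le (Finset.card_le_univ s))]
  refine Finset.sum_congr rfl fun k _ => ?_
  rw [← Finset.sum_filter, Finset.filter_filter, Finset.sum_congr rfl (g := fun _ => B ^ k)
    (fun s hs => by rw [(Finset.mem_filter.1 hs).2.1]), Finset.sum_const, smul_eq_mul, indepCount,
    ← Set.ncard_coe_finset]
  congr 2
  ext s
  simp [SimpleGraph.isNIndepSet_iff, and_comm]

/-- The digits of `indepSum G (uniformWeight B)` are the numbers of independent sets, so that a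
check of these digits decides unimodality and log-concavity. -/
theorem unimodal_not_logConcave_of_digitCheck (G : SimpleGraph V) {B n : ℕ}
    (hB : 2 ^ Fintype.card V < B)
    (h : digitCheck B n (indepSum G (uniformWeight B)) = true) :
    PolyUnimodal (indepPoly G) ∧ ¬ PolyLogConcave (indepPoly G) := by
  set N := indepSum G (uniformWeight B) with hN
  simp only [digitCheck, Bool.and_eq_true, Nat.blt_eq] at h
  obtain ⟨hlt, huni, hviol⟩ := h
  have hdigit : ∀ k, N / B ^ k % B = indepCount G k := by
    intro k
    -- Padding with zero terms brings position `k` into range even when `k` exceeds |V|.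
    have hext : N = ∑ i ∈ Finset.range (Fintype.card V + 1 + k), indepCount G i * B ^ i := by
      rw [hN, indepSum_uniformWeight]
      refine Finset.sum_subset (Finset.range_subset_range.2 (by omega)) fun i _ hi => ?_
      rw [indepCount_eq_zero G (by rw [Finset.mem_range] at hi; omega), zero_mul]
    rw [hext]
    exact sum_div_pow_mod (fun i => (indepCount_le G i).trans_lt hB) (by omega)
  have hcoeff : ∀ k, (indepPoly G).coeff k = (lowDigits B n N).getD k 0 := by
    intro k
    rw [coeff_indepPoly, ← hdigit]
    -- From position `n` on, the digits vanish because the check includes `N < B ^ n`.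
    rcases lt_or_ge k n with hk | hk
    · rw [getD_lowDigits B hk]
    · rw [List.getD_eq_default _ _ (by rwa [length_lowDigits]), Nat.div_eq_of_lt, Nat.zero_mod]
      exact hlt.trans_le (Nat.pow_le_pow_right ((Nat.zero_le _).trans_lt hB) hk)
  constructor
  · obtain ⟨p, hup, hdown⟩ := exists_peak_of_isUnimodal huni
    refine SeqUnimodal.of_peak _ p (fun i hi => ?_) (fun i hi => ?_)
    · simpa only [hcoeff] using hup i hi
    · simpa only [hcoeff] using hdown i hi
  · obtain ⟨i, hi⟩ := exists_of_violatesLogConcavity hviol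
    simp only [List.getD_eq_getElem?_getD, List.getElem?_drop] at hi
    exact not_polyLogConcave (i := n - 8 + i)
      (by simpa only [hcoeff, List.getD_eq_getElem?_getD, add_assoc] using hi)

/-- A finite tree such that all its pairs of vertices pass the digit check. -/
theorem universalEnlargement_of_digitCheck [DecidableEq V] {T : SimpleGraph V} (hT : T.IsTree)
    {B n : ℕ} (hB : 2 ^ Fintype.card V < B)
    (h : ∀ u v, u ≠ v → digitCheck B n
      (indepSum T (uniformWeight B) - indepSum T (forcedWeight B u v)) = true) :
    UniversalEnlargement T := by
  refine ⟨hT, fun e he => ⟨hT.isUnicyclic_addEdge he, ?_⟩⟩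
  induction e with | _ u v =>
  have huv : u ≠ v := ((T.compl_adj u v).1 he).1
  refine unimodal_not_logConcave_of_digitCheck (n := n) _ hB ?_
  rw [Nat.eq_sub_of_add_eq (indepSum_addEdge T B huv)]
  exact h u v huv

end WeightedSums

/-! ### Galvin's tree: structure and leaf-to-root summation. -/

/-- The weight of an edge whose ends are chosen according to `b` and `b'`. -/
def edgeWeight (b b' : Bool) : ℕ := bif b && b' then 0 else 1

theorem edgeWeight_eq_ite (b b' : Bool) :
    edgeWeight b b' = if ¬ (b = true ∧ b' = true) then 1 else 0 := by
  cases b <;> cases b' <;> simp [edgeWeight]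

theorem prod_prod_boole {ι κ : Type*} [Fintype ι] [Fintype κ] (p : ι → κ → Prop)
    [∀ i j, Decidable (p i j)] :
    ∏ i, ∏ j, (if p i j then 1 else 0 : ℕ) = if ∀ i j, p i j then 1 else 0 := by
  rw [← Fintype.prod_prod_type', Fintype.prod_boole]
  simp only [Prod.forall]

namespace GalvinVertex

variable {m t : ℕ}

/-- The vertices of Galvin's tree as a sum type. -/
def equivSum (m t : ℕ) :
    GalvinVertex m t ≃ Unit ⊕ Fin m ⊕ (Fin m × Fin t) ⊕ (Fin m × Fin t) where
  toFun
    | root => .inl ()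
    | child i => .inr (.inl i)
    | mid i j => .inr (.inr (.inl (i, j)))
    | tip i j => .inr (.inr (.inr (i, j)))
  invFun
    | .inl () => root
    | .inr (.inl i) => child i
    | .inr (.inr (.inl (i, j))) => mid i j
    | .inr (.inr (.inr (i, j))) => tip i j
  left_inv x := by cases x <;> rfl
  right_inv x := by rcases x with _ | _ | _ | _ <;> rfl

/-- Boolean equality of vertices of Galvin's tree. -/
def beq : GalvinVertex m t → GalvinVertex m t → Bool
  | root, root => true
  | child i, child i' => Nat.beq i i'
  | mid i j, mid i' j' => Nat.beq i i' && Nat.beq j j'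
  | tip i j, tip i' j' => Nat.beq i i' && Nat.beq j j'
  | _, _ => false

theorem beq_eq_true_iff (x y : GalvinVertex m t) : beq x y = true ↔ x = y := by
  cases x <;> cases y <;> simp [beq, Fin.ext_iff]

instance : DecidableEq (GalvinVertex m t) := fun x y =>
  decidable_of_bool (beq x y) (beq_eq_true_iff x y)

instance : Fintype (GalvinVertex m t) := Fintype.ofEquiv _ (equivSum m t).symm

theorem card_eq (m t : ℕ) : Fintype.card (GalvinVertex m t) = m + 2 * (m * t) + 1 := by
  rw [Fintype.card_congr (equivSum m t)]
  simp
  ring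

theorem prod_univ (g : GalvinVertex m t → ℕ) :
    ∏ x, g x = g root * ∏ i, (g (child i) * ∏ j, (g (mid i j) * g (tip i j))) := by
  rw [← (equivSum m t).symm.prod_comp]
  simp only [Fintype.prod_sum_type, Fintype.prod_prod_type, Finset.prod_mul_distrib,
    Finset.univ_unique, Finset.prod_singleton]
  rfl

/-- A Boolean labelling of Galvin's tree, branch by branch. -/
def labellingEquiv (m t : ℕ) :
    (GalvinVertex m t → Bool) ≃ Bool × (Fin m → Bool × (Fin t → Bool × Bool)) where
  toFun f := (f root, fun i => (f (child i), fun j => (f (mid i j), f (tip i j))))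
  invFun p
    | root => p.1
    | child i => (p.2 i).1
    | mid i j => ((p.2 i).2 j).1
    | tip i j => ((p.2 i).2 j).2
  left_inv f := by funext x; cases x <;> rfl
  right_inv p := rfl

/-- The parent of a vertex of Galvin's tree. -/
def parent : GalvinVertex m t → GalvinVertex m t
  | root => root
  | child _ => root
  | mid i _ => child i
  | tip i j => mid i j

/-- The distance of a vertex of Galvin's tree from the root. -/
def depth : GalvinVertex m t → ℕ
  | root => 0
  | child _ => 1
  | mid _ _ => 2
  | tip _ _ => 3

theorem depth_parent_lt {x : GalvinVertex m t} (hx : x ≠ root) : depth (parent x) < depth x := by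
  cases x <;> simp_all [parent, depth]

theorem rel_iff {x y : GalvinVertex m t} : GalvinRel m t x y ↔ y ≠ root ∧ parent y = x := by
  constructor
  · rintro (_ | _ | _) <;> simp [parent]
  · rintro ⟨hy, rfl⟩
    cases y with
    | root => exact absurd rfl hy
    | child i => exact .root_child i
    | mid i j => exact .child_mid i j
    | tip i j => exact .mid_tip i j

theorem isTree (m t : ℕ) : (galvinTree m t).IsTree := by
  refine SimpleGraph.isTree_of_parent root parent depth (fun x hx => depth_parent_lt hx)
    (fun x hx => ?_) (fun x y h => ?_)
  · rw [galvinTree, SimpleGraph.fromRel_adj]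
    refine ⟨fun h => ?_, Or.inr (rel_iff.2 ⟨hx, rfl⟩)⟩
    have := depth_parent_lt hx
    rw [← h] at this
    exact lt_irrefl _ this
  · rw [galvinTree, SimpleGraph.fromRel_adj, rel_iff, rel_iff] at h
    exact h.2.symm

theorem forall_adj_iff (f : GalvinVertex m t → Bool) :
    (∀ x y, (galvinTree m t).Adj x y → ¬ (f x = true ∧ f y = true)) ↔
      ∀ x y, GalvinRel m t x y → ¬ (f x = true ∧ f y = true) := by
  simp only [galvinTree, SimpleGraph.fromRel_adj]
  refine ⟨fun h x y hxy => h x y ⟨?_, Or.inl hxy⟩, fun h x y hxy => ?_⟩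
  · rcases hxy with _ | _ | _ <;> simp
  · rcases hxy.2 with hr | hr
    · exact h x y hr
    · exact fun hf => h y x hr hf.symm

/-- The product over the edges of Galvin's tree of the edge weights of a labelling. -/
theorem edge_prod (f : GalvinVertex m t → Bool) [Decidable (∀ x y, (galvinTree m t).Adj x y →
      ¬ (f x = true ∧ f y = true))] :
    ∏ i, (edgeWeight (f root) (f (child i)) * ∏ j, (edgeWeight (f (child i)) (f (mid i j)) *
      edgeWeight (f (mid i j)) (f (tip i j)))) =
    if ∀ x y, (galvinTree m t).Adj x y → ¬ (f x = true ∧ f y = true) then 1 else 0 := by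
  have hiff : (∀ x y, (galvinTree m t).Adj x y → ¬ (f x = true ∧ f y = true)) ↔
      (∀ i, ¬ (f root = true ∧ f (child i) = true)) ∧
      (∀ i j, ¬ (f (child i) = true ∧ f (mid i j) = true)) ∧
      (∀ i j, ¬ (f (mid i j) = true ∧ f (tip i j) = true)) := by
    rw [forall_adj_iff]
    refine ⟨fun h => ⟨fun i => h _ _ (.root_child i), fun i j => h _ _ (.child_mid i j),
      fun i j => h _ _ (.mid_tip i j)⟩, ?_⟩
    rintro ⟨h1, h2, h3⟩ x y (i | ⟨i, j⟩ | ⟨i, j⟩)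
    · exact h1 i
    · exact h2 i j
    · exact h3 i j
  simp only [hiff, edgeWeight_eq_ite, Finset.prod_mul_distrib, prod_prod_boole]
  rw [Fintype.prod_boole, ite_zero_mul_ite_zero, ite_zero_mul_ite_zero, one_mul, one_mul]
  congr

end GalvinVertex

open GalvinVertex in
/-- The weighted sum of the independent sets of Galvin's tree, computed from the leaves up; the
weight `r` of the root is separate from the others. -/
def galvinSum (m t : ℕ) (r : Bool → ℕ) (w : GalvinVertex m t → Bool → ℕ) : ℕ :=
  ∑ b, r b * ∏ i, ∑ c, edgeWeight b c * w (child i) c *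
    ∏ j, ∑ d, edgeWeight c d * w (mid i j) d * ∑ e, edgeWeight d e * w (tip i j) e

-- Distributivity: a labelling is a root bit together with an independent choice for each branch,
-- and within it for each arm, so the sum of products becomes nested products of sums.
open GalvinVertex in
theorem sum_edge_prod (m t : ℕ) (r : Bool → ℕ) (w : GalvinVertex m t → Bool → ℕ) :
    ∑ f : GalvinVertex m t → Bool, r (f root) *
      ∏ i, (edgeWeight (f root) (f (child i)) * w (child i) (f (child i)) *
        ∏ j, (edgeWeight (f (child i)) (f (mid i j)) * w (mid i j) (f (mid i j)) *
          (edgeWeight (f (mid i j)) (f (tip i j)) * w (tip i j) (f (tip i j)))))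
      = galvinSum m t r w := by
  rw [← (labellingEquiv m t).symm.sum_comp, Fintype.sum_prod_type, galvinSum]
  refine Finset.sum_congr rfl fun b _ => ?_
  change ∑ p : Fin m → Bool × (Fin t → Bool × Bool), r b * ∏ i,
    (edgeWeight b (p i).1 * w (child i) (p i).1 * ∏ j,
      (edgeWeight (p i).1 ((p i).2 j).1 * w (mid i j) ((p i).2 j).1 *
        (edgeWeight ((p i).2 j).1 ((p i).2 j).2 * w (tip i j) ((p i).2 j).2))) = _
  rw [← Finset.mul_sum, ← Fintype.prod_sum fun i (q : Bool × (Fin t → Bool × Bool)) =>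
    edgeWeight b q.1 * w (child i) q.1 * ∏ j, (edgeWeight q.1 (q.2 j).1 * w (mid i j) (q.2 j).1 *
        (edgeWeight (q.2 j).1 (q.2 j).2 * w (tip i j) (q.2 j).2))]
  congr 1
  refine Finset.prod_congr rfl fun i _ => ?_
  rw [Fintype.sum_prod_type]
  refine Finset.sum_congr rfl fun c _ => ?_
  dsimp only
  rw [← Finset.mul_sum, ← Fintype.prod_sum fun j (q : Bool × Bool) =>
    edgeWeight c q.1 * w (mid i j) q.1 * (edgeWeight q.1 q.2 * w (tip i j) q.2)]
  simp only [Fintype.sum_prod_type, Finset.mul_sum]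

-- The free factor `r` leaves room for the edge from `v_0` to the root of a copy when Galvin trees
-- are assembled into a Bautista-Ramos tree.
open GalvinVertex in
open scoped Classical in
theorem sum_indep_galvinTree (m t : ℕ) (r : Bool → ℕ) (w : GalvinVertex m t → Bool → ℕ) :
    (∑ f : GalvinVertex m t → Bool, r (f root) *
      if ∀ x y, (galvinTree m t).Adj x y → ¬ (f x = true ∧ f y = true)
        then ∏ x, w x (f x) else 0)
      = galvinSum m t (fun b => r b * w root b) w := by
  rw [← sum_edge_prod]
  refine Finset.sum_congr rfl fun f _ => ?_
  rw [← mul_boole, ← edge_prod, GalvinVertex.prod_univ]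
  simp only [Finset.prod_mul_distrib]
  ring

theorem indepSum_galvinTree (m t : ℕ) (w : GalvinVertex m t → Bool → ℕ) :
    indepSum (galvinTree m t) w = galvinSum m t (w .root) w := by
  have h := sum_indep_galvinTree m t (fun _ => 1) w
  simp only [one_mul] at h
  rw [indepSum, ← h]
  congr!

/-! ### The Bautista-Ramos tree: structure and leaf-to-root summation. -/

namespace BRVertex

variable {m t : ℕ}

/-- The vertices of the Bautista-Ramos tree as a sum type. -/
def equivSum (m t : ℕ) : BRVertex m t ≃ Bool ⊕ (Fin m × GalvinVertex 3 t) where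
  toFun
    | root => .inl false
    | leaf => .inl true
    | copy i x => .inr (i, x)
  invFun
    | .inl false => root
    | .inl true => leaf
    | .inr (i, x) => copy i x
  left_inv x := by cases x <;> rfl
  right_inv x := by rcases x with (_ | _) | _ <;> rfl

/-- Boolean equality of vertices of the Bautista-Ramos tree. -/
def beq : BRVertex m t → BRVertex m t → Bool
  | root, root => true
  | leaf, leaf => true
  | copy i x, copy i' x' => Nat.beq i i' && x.beq x'
  | _, _ => false

theorem beq_eq_true_iff (x y : BRVertex m t) : beq x y = true ↔ x = y := by
  cases x <;> cases y <;> simp [beq, Fin.ext_iff, GalvinVertex.beq_eq_true_iff]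

instance : DecidableEq (BRVertex m t) := fun x y =>
  decidable_of_bool (beq x y) (beq_eq_true_iff x y)

instance : Fintype (BRVertex m t) := Fintype.ofEquiv _ (equivSum m t).symm

theorem card_eq (m t : ℕ) : Fintype.card (BRVertex m t) = m * (6 * t + 4) + 1 + 1 := by
  rw [Fintype.card_congr (equivSum m t)]
  simp only [Fintype.card_sum, Fintype.card_prod, Fintype.card_fin, Fintype.card_bool,
    GalvinVertex.card_eq]
  ring

theorem prod_univ (g : BRVertex m t → ℕ) :
    ∏ x, g x = g root * g leaf * ∏ i, ∏ x, g (copy i x) := by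
  rw [← (equivSum m t).symm.prod_comp]
  simp only [Fintype.prod_sum_type, Fintype.prod_prod_type, Fintype.prod_bool]
  rw [mul_comm (g ((equivSum m t).symm (Sum.inl true)))]
  rfl

/-- A Boolean labelling of the Bautista-Ramos tree, copy by copy. -/
def labellingEquiv (m t : ℕ) :
    (BRVertex m t → Bool) ≃ Bool × Bool × (Fin m → GalvinVertex 3 t → Bool) where
  toFun f := (f root, f leaf, fun i x => f (copy i x))
  invFun p
    | root => p.1
    | leaf => p.2.1
    | copy i x => p.2.2 i x
  left_inv f := by funext x; cases x <;> rfl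
  right_inv p := rfl

/-- The parent of a vertex of the Bautista-Ramos tree. -/
def parent : BRVertex m t → BRVertex m t
  | root => root
  | leaf => root
  | copy _ .root => root
  | copy i x => copy i x.parent

/-- The distance of a vertex of the Bautista-Ramos tree from the root. -/
def depth : BRVertex m t → ℕ
  | root => 0
  | leaf => 1
  | copy _ x => x.depth + 1

theorem depth_parent_lt {x : BRVertex m t} (hx : x ≠ root) : depth (parent x) < depth x := by
  rcases x with _ | _ | ⟨i, _ | _ | _ | _⟩ <;>
    simp_all [parent, depth, GalvinVertex.parent, GalvinVertex.depth]

theorem rel_iff {x y : BRVertex m t} : BRRel m t x y ↔ y ≠ root ∧ parent y = x := by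
  constructor
  · rintro (_ | _ | ⟨i, h⟩)
    · simp [parent]
    · simp [parent]
    · rcases h with _ | _ | _ <;> simp [parent, GalvinVertex.parent]
  · rintro ⟨hy, rfl⟩
    rcases y with _ | _ | ⟨i, _ | _ | _ | _⟩
    · exact absurd rfl hy
    · exact .root_leaf
    · exact .root_copy i
    · exact .copy_copy i (.root_child _)
    · exact .copy_copy i (.child_mid _ _)
    · exact .copy_copy i (.mid_tip _ _)

theorem isTree (m t : ℕ) : (brTree m t).IsTree := by
  refine SimpleGraph.isTree_of_parent root parent depth (fun x hx => depth_parent_lt hx)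
    (fun x hx => ?_) (fun x y h => ?_)
  · rw [brTree, SimpleGraph.fromRel_adj]
    refine ⟨fun h => ?_, Or.inr (rel_iff.2 ⟨hx, rfl⟩)⟩
    have := depth_parent_lt hx
    rw [← h] at this
    exact lt_irrefl _ this
  · rw [brTree, SimpleGraph.fromRel_adj, rel_iff, rel_iff] at h
    exact h.2.symm

theorem forall_adj_iff (f : BRVertex m t → Bool) :
    (∀ x y, (brTree m t).Adj x y → ¬ (f x = true ∧ f y = true)) ↔
      ¬ (f root = true ∧ f leaf = true) ∧
      (∀ i, ¬ (f root = true ∧ f (copy i .root) = true)) ∧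
      ∀ i x y, (galvinTree 3 t).Adj x y → ¬ (f (copy i x) = true ∧ f (copy i y) = true) := by
  simp only [GalvinVertex.forall_adj_iff fun x => f (copy _ x)]
  simp only [brTree, SimpleGraph.fromRel_adj]
  constructor
  · have hne : ∀ {x y : BRVertex m t}, BRRel m t x y → x ≠ y := by
      intro x y hr he
      have := rel_iff.1 hr
      have h1 := depth_parent_lt this.1
      rw [this.2, he] at h1
      exact lt_irrefl _ h1
    intro h
    have h' : ∀ x y, BRRel m t x y → ¬ (f x = true ∧ f y = true) :=
      fun x y hr => h x y ⟨hne hr, Or.inl hr⟩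
    exact ⟨h' _ _ .root_leaf, fun i => h' _ _ (.root_copy i),
      fun i x y hr => h' _ _ (.copy_copy i hr)⟩
  · rintro ⟨h1, h2, h3⟩ x y ⟨-, hr⟩
    have h' : ∀ x y, BRRel m t x y → ¬ (f x = true ∧ f y = true) := by
      rintro x y (_ | i | ⟨i, hr⟩)
      · exact h1
      · exact h2 i
      · exact h3 i _ _ hr
    rcases hr with hr | hr
    · exact h' x y hr
    · exact fun hf => h' y x hr hf.symm

end BRVertex

open BRVertex in
/-- The weighted sum of the independent sets of the Bautista-Ramos tree, computed from the leaves
up. -/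
def brSum (m t : ℕ) (w : BRVertex m t → Bool → ℕ) : ℕ :=
  ∑ b, w root b * (∑ c, edgeWeight b c * w leaf c) *
    ∏ i, galvinSum 3 t (fun c => edgeWeight b c * w (copy i .root) c) (fun x => w (copy i x))

-- Once the labels of `v_0` and its leaf are fixed, the copies are independent of each other; the
-- label of `v_0` reaches a copy only through the factor `edgeWeight b` at its root.
open BRVertex in
theorem indepSum_brTree (m t : ℕ) (w : BRVertex m t → Bool → ℕ) :
    indepSum (brTree m t) w = brSum m t w := by
  classical
  trans ∑ f : BRVertex m t → Bool,
    if ∀ x y, (brTree m t).Adj x y → ¬ (f x = true ∧ f y = true) then ∏ x, w x (f x) else 0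
  · rw [indepSum]
    congr!
  rw [← (labellingEquiv m t).symm.sum_comp, Fintype.sum_prod_type, brSum]
  refine Finset.sum_congr rfl fun b _ => ?_
  rw [Fintype.sum_prod_type, Finset.mul_sum, Finset.sum_mul]
  refine Finset.sum_congr rfl fun c _ => ?_
  rw [Finset.prod_congr rfl fun i _ =>
    (sum_indep_galvinTree 3 t (edgeWeight b) fun x => w (copy i x)).symm, Fintype.prod_sum, Finset.mul_sum]
  refine Finset.sum_congr rfl fun g _ => ?_
  simp only [forall_adj_iff, BRVertex.prod_univ]
  change (if ¬ (b = true ∧ c = true) ∧ (∀ i, ¬ (b = true ∧ g i .root = true)) ∧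
      ∀ i x y, (galvinTree 3 t).Adj x y → ¬ (g i x = true ∧ g i y = true)
    then w root b * w leaf c * ∏ i, ∏ x, w (copy i x) (g i x) else 0) = _
  have hsplit : (∏ i, if ∀ x y, (galvinTree 3 t).Adj x y → ¬ (g i x = true ∧ g i y = true)
      then ∏ x, w (copy i x) (g i x) else 0) =
      (if ∀ i x y, (galvinTree 3 t).Adj x y → ¬ (g i x = true ∧ g i y = true) then 1 else 0) *
        ∏ i, ∏ x, w (copy i x) (g i x) := by
    split_ifs with h3
    · rw [one_mul]
      exact Finset.prod_congr rfl fun i _ => if_pos (h3 i)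
    · obtain ⟨i, hi⟩ := not_forall.1 h3
      rw [zero_mul]
      exact Finset.prod_eq_zero (Finset.mem_univ i) (if_neg hi)
  rw [Finset.prod_mul_distrib, hsplit]
  simp only [edgeWeight_eq_ite, Fintype.prod_boole]
  by_cases h1 : ¬ (b = true ∧ c = true)
  · by_cases h2 : ∀ i, ¬ (b = true ∧ g i .root = true)
    · by_cases h3 : ∀ i x y, (galvinTree 3 t).Adj x y → ¬ (g i x = true ∧ g i y = true)
      · rw [if_pos ⟨h1, h2, h3⟩, if_pos h1, if_pos h2, if_pos h3]
        ring
      · rw [if_neg (fun h => h3 h.2.2), if_neg h3]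
        ring
    · rw [if_neg (fun h => h2 h.2.1), if_neg h2]
      ring
  · rw [if_neg (fun h => h1 h.1), if_neg h1]
    ring

/-! ### Reduction by automorphisms to pairs in the first two copies, branches and arms. -/

section Symmetry

/-- One transposition takes `a` to 0; a second, fixing 0, takes the image of `b` to 1 if it is not
already 0. -/
theorem exists_perm_apply_eq_zero {n : ℕ} (a b : Fin (n + 2)) :
    ∃ σ : Equiv.Perm (Fin (n + 2)), σ a = 0 ∧ (σ b = 0 ∨ σ b = 1) := by
  by_cases h : Equiv.swap a 0 b = 0
  · exact ⟨Equiv.swap a 0, Equiv.swap_apply_left _ _, Or.inl h⟩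
  · refine ⟨(Equiv.swap a 0).trans (Equiv.swap (Equiv.swap a 0 b) 1), ?_, Or.inr ?_⟩
    · rw [Equiv.trans_apply, Equiv.swap_apply_left]
      exact Equiv.swap_apply_of_ne_of_ne (Ne.symm h) (by simp)
    · rw [Equiv.trans_apply, Equiv.swap_apply_left]

theorem prod_fin_add_two {n : ℕ} {F : Fin (n + 2) → ℕ} {c : ℕ} (h : ∀ i : Fin n, F i.succ.succ = c) :
    ∏ i, F i = F 0 * F 1 * c ^ n := by
  simp [Fin.prod_univ_succ, h, mul_assoc]

theorem forcedWeight_eq_uniformWeight {V : Type*} [DecidableEq V] (B : ℕ) {u v x : V}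
    (hu : x ≠ u) (hv : x ≠ v) : forcedWeight B u v x = uniformWeight B x := by
  funext b
  simp [forcedWeight, uniformWeight, hu, hv]

theorem forcedWeight_map {V : Type*} [DecidableEq V] (B : ℕ) {φ : V → V}
    (hφ : Function.Injective φ) (u v x : V) :
    forcedWeight B (φ u) (φ v) (φ x) = forcedWeight B u v x := by
  funext b
  simp only [forcedWeight, hφ.eq_iff]

namespace GalvinVertex

variable {m t : ℕ}

/-- The action on Galvin's tree of permutations of the branches and of the arms. -/
def perm (σ : Equiv.Perm (Fin m)) (τ : Equiv.Perm (Fin t)) : GalvinVertex m t → GalvinVertex m t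
  | root => root
  | child i => child (σ i)
  | mid i j => mid (σ i) (τ j)
  | tip i j => tip (σ i) (τ j)

theorem perm_injective (σ : Equiv.Perm (Fin m)) (τ : Equiv.Perm (Fin t)) :
    Function.Injective (perm σ τ) := by
  intro x y h
  cases x <;> cases y <;> simp_all [perm]

theorem galvinSum_perm (σ : Equiv.Perm (Fin m)) (τ : Equiv.Perm (Fin t)) (r : Bool → ℕ)
    (w : GalvinVertex m t → Bool → ℕ) :
    galvinSum m t r (fun x => w (perm σ τ x)) = galvinSum m t r w := by
  refine Finset.sum_congr rfl fun b _ => congrArg _ ?_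
  refine Fintype.prod_equiv σ _ _ fun i => Finset.sum_congr rfl fun c _ => congrArg _ ?_
  exact Fintype.prod_equiv τ _ _ fun j => rfl

/-- The branch of a vertex. -/
def branch : GalvinVertex (m + 1) t → Fin (m + 1)
  | root => 0
  | child i => i
  | mid i _ => i
  | tip i _ => i

/-- The arm of a vertex. -/
def arm : GalvinVertex m (t + 1) → Fin (t + 1)
  | root => 0
  | child _ => 0
  | mid _ j => j
  | tip _ j => j

/-- The vertices of the first arm of the first branch, with the root. -/
def firstArm (m t : ℕ) : List (GalvinVertex (m + 2) (t + 2)) :=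
  [root, child 0, mid 0 0, tip 0 0]

/-- The vertices of the first two arms of the first two branches, with the root. -/
def firstArms (m t : ℕ) : List (GalvinVertex (m + 2) (t + 2)) :=
  [root, child 0, child 1, mid 0 0, mid 0 1, mid 1 0, mid 1 1, tip 0 0, tip 0 1, tip 1 0, tip 1 1]

theorem firstArm_subset (m t : ℕ) : firstArm m t ⊆ firstArms m t := by
  simp [firstArm, firstArms]

theorem notMem_firstArms_of_branch {x : GalvinVertex (m + 2) (t + 2)} (i : Fin m)
    (hx : x.branch = i.succ.succ) : x ∉ firstArms m t := by
  intro h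
  simp only [firstArms, List.mem_cons, List.not_mem_nil, or_false] at h
  rcases h with rfl | rfl | rfl | rfl | rfl | rfl | rfl | rfl | rfl | rfl | rfl <;>
    simp [branch, Fin.ext_iff] at hx

theorem notMem_firstArms_of_arm {x : GalvinVertex (m + 2) (t + 2)} (j : Fin t)
    (hx : x.arm = j.succ.succ) : x ∉ firstArms m t := by
  intro h
  simp only [firstArms, List.mem_cons, List.not_mem_nil, or_false] at h
  rcases h with rfl | rfl | rfl | rfl | rfl | rfl | rfl | rfl | rfl | rfl | rfl <;>
    simp [arm, Fin.ext_iff] at hx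

theorem perm_mem_firstArm {σ : Equiv.Perm (Fin (m + 2))} {τ : Equiv.Perm (Fin (t + 2))}
    {u : GalvinVertex (m + 2) (t + 2)} (hσ : σ u.branch = 0) (hτ : τ u.arm = 0) :
    perm σ τ u ∈ firstArm m t := by
  cases u <;> simp_all [perm, firstArm, branch, arm]

theorem perm_mem_firstArms {σ : Equiv.Perm (Fin (m + 2))} {τ : Equiv.Perm (Fin (t + 2))}
    {v : GalvinVertex (m + 2) (t + 2)} (hσ : σ v.branch = 0 ∨ σ v.branch = 1)
    (hτ : τ v.arm = 0 ∨ τ v.arm = 1) : perm σ τ v ∈ firstArms m t := by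
  cases v <;> rcases hσ with hσ | hσ <;> rcases hτ with hτ | hτ <;>
    simp_all [perm, firstArms, branch, arm]

/-- The weighted sum of the independent sets of the arm `mid i j, tip i j`, where `c` tells whether
`child i` is chosen. -/
def armSum (w : GalvinVertex m t → Bool → ℕ) (c : Bool) (i : Fin m) (j : Fin t) : ℕ :=
  (bif c then 0 else w (mid i j) true * w (tip i j) false) +
    w (mid i j) false * (w (tip i j) true + w (tip i j) false)

theorem armSum_eq_sum (w : GalvinVertex m t → Bool → ℕ) (c : Bool) (i : Fin m) (j : Fin t) :
    armSum w c i j = ∑ d, edgeWeight c d * w (mid i j) d * ∑ e, edgeWeight d e * w (tip i j) e := by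
  cases c <;> simp [armSum, edgeWeight]

/-- The value of `armSum` for the uniform weight. -/
def uniformArmSum (B : ℕ) (c : Bool) : ℕ := bif c then 1 + B else 1 + B + B

/-- The value of the sum over a branch for the uniform weight, where `b` tells whether the root is
chosen. -/
def uniformBranchSum (B t : ℕ) (b : Bool) : ℕ :=
  uniformArmSum B false ^ t + bif b then 0 else B * uniformArmSum B true ^ t

/-- The weighted sum over the branch `i` for a weight that is uniform outside the first two arms. -/
def branchSumOfUniform (B : ℕ) (w : GalvinVertex m (t + 2) → Bool → ℕ) (b : Bool) (i : Fin m) : ℕ :=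
  (bif b then 0 else
    w (child i) true * (armSum w true i 0 * armSum w true i 1 * uniformArmSum B true ^ t)) +
  w (child i) false * (armSum w false i 0 * armSum w false i 1 * uniformArmSum B false ^ t)

theorem branchSumOfUniform_eq_sum (B : ℕ) (w : GalvinVertex m (t + 2) → Bool → ℕ) (b : Bool)
    (i : Fin m) : branchSumOfUniform B w b i = ∑ c, edgeWeight b c * w (child i) c *
      (armSum w c i 0 * armSum w c i 1 * uniformArmSum B c ^ t) := by
  cases b <;> simp [branchSumOfUniform, edgeWeight]

/-- The value of `galvinSum` for a weight that is uniform outside `firstArms`. -/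
def galvinSumOfUniform (B : ℕ) (r : Bool → ℕ) (w : GalvinVertex (m + 2) (t + 2) → Bool → ℕ) : ℕ :=
  r true * (branchSumOfUniform B w true 0 * branchSumOfUniform B w true 1 *
    uniformBranchSum B (t + 2) true ^ m) +
  r false * (branchSumOfUniform B w false 0 * branchSumOfUniform B w false 1 *
    uniformBranchSum B (t + 2) false ^ m)

theorem armSum_eq_uniformArmSum {B : ℕ} {w : GalvinVertex m t → Bool → ℕ} {i : Fin m} {j : Fin t}
    (hmid : w (mid i j) = uniformWeight B (mid i j))
    (htip : w (tip i j) = uniformWeight B (tip i j)) (c : Bool) :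
    armSum w c i j = uniformArmSum B c := by
  rw [armSum, hmid, htip]
  cases c <;> simp [uniformArmSum, uniformWeight] <;>
    ring

/-- All arms past the second in a branch, and all branches past the second, contribute equal
factors, which collapse into powers. What remains is a closed expression cheap to evaluate. -/
theorem galvinSum_eq_galvinSumOfUniform {B : ℕ} {w : GalvinVertex (m + 2) (t + 2) → Bool → ℕ}
    (hw : ∀ x ∉ firstArms m t, w x = uniformWeight B x) (r : Bool → ℕ) :
    galvinSum (m + 2) (t + 2) r w = galvinSumOfUniform B r w := by
  rw [galvinSumOfUniform, ← Fintype.sum_bool fun b => r b * (branchSumOfUniform B w b 0 *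
    branchSumOfUniform B w b 1 * uniformBranchSum B (t + 2) b ^ m)]
  refine Finset.sum_congr rfl fun b _ => congrArg _ ?_
  simp only [← armSum_eq_sum]
  rw [prod_fin_add_two (c := uniformBranchSum B (t + 2) b)]
  · simp only [branchSumOfUniform_eq_sum]
    congr 2 <;>
    · refine Finset.sum_congr rfl fun c _ => congrArg _ (prod_fin_add_two fun j => ?_)
      exact armSum_eq_uniformArmSum (hw _ (notMem_firstArms_of_arm j rfl))
        (hw _ (notMem_firstArms_of_arm j rfl)) c
  · intro i
    have harm : ∀ c j, armSum w c i.succ.succ j = uniformArmSum B c := fun c j =>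
      armSum_eq_uniformArmSum (hw _ (notMem_firstArms_of_branch i rfl))
        (hw _ (notMem_firstArms_of_branch i rfl)) c
    simp only [harm, hw (child i.succ.succ) (notMem_firstArms_of_branch i rfl), Finset.prod_const,
      Finset.card_univ, Fintype.card_fin, Fintype.sum_bool, uniformWeight, uniformBranchSum]
    cases b <;> simp [edgeWeight, add_comm]

/-- The digit check for the pairs of vertices in the first two arms of the first two branches. -/
def pairsCheck (B n m t : ℕ) : Bool :=
  (firstArm m t).all fun u => (firstArms m t).all fun v => beq u v || digitCheck B n
    (galvinSumOfUniform (m := m) (t := t) B (fun b => bif b then B else 1) (uniformWeight B) -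
      galvinSumOfUniform B (forcedWeight B u v root) (forcedWeight B u v))

theorem universalEnlargement_galvinTree {B n : ℕ}
    (hB : 2 ^ ((m + 2) + 2 * ((m + 2) * (t + 2)) + 1) < B)
    (h : pairsCheck B n m t = true) :
    UniversalEnlargement (galvinTree (m + 2) (t + 2)) := by
  refine universalEnlargement_of_digitCheck (B := B) (n := n) (isTree _ _) (by rwa [card_eq]) ?_
  intro u v huv
  -- A vertex without a branch or arm index has the default 0, which only imposes a harmless extra
  -- condition on the permutation.
  obtain ⟨σ, hσu, hσv⟩ := exists_perm_apply_eq_zero u.branch v.branch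
  obtain ⟨τ, hτu, hτv⟩ := exists_perm_apply_eq_zero u.arm v.arm
  have hinj := perm_injective σ τ
  have hu := perm_mem_firstArm hσu hτu
  have hv := perm_mem_firstArms hσv hτv
  simp only [pairsCheck, List.all_eq_true, Bool.or_eq_true, beq_eq_true_iff] at h
  have := (h _ hu _ hv).resolve_left (hinj.ne huv)
  rw [← galvinSum_eq_galvinSumOfUniform fun _ _ => rfl,
    ← galvinSum_eq_galvinSumOfUniform fun x hx => forcedWeight_eq_uniformWeight B
      (fun h => hx (h ▸ firstArm_subset _ _ hu)) (fun h => hx (h ▸ hv))] at this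
  -- Transporting the weight along the automorphism returns the forced pair from the images to `u`
  -- and `v` themselves.
  rw [← galvinSum_perm σ τ _ (forcedWeight B _ _)] at this
  simp only [forcedWeight_map B hinj] at this
  rw [indepSum_galvinTree, indepSum_galvinTree]
  rwa [show forcedWeight B (perm σ τ u) (perm σ τ v) root = forcedWeight B u v root from
    forcedWeight_map B hinj u v root] at this

end GalvinVertex

namespace BRVertex

variable {m t : ℕ}

/-- The action on the Bautista-Ramos tree of permutations of the copies, of the branches, and of
the arms. -/
def perm (ρ : Equiv.Perm (Fin m)) (σ : Equiv.Perm (Fin 3)) (τ : Equiv.Perm (Fin t)) :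
    BRVertex m t → BRVertex m t
  | root => root
  | leaf => leaf
  | copy i x => copy (ρ i) (x.perm σ τ)

theorem perm_injective (ρ : Equiv.Perm (Fin m)) (σ : Equiv.Perm (Fin 3))
    (τ : Equiv.Perm (Fin t)) : Function.Injective (perm ρ σ τ) := by
  intro x y h
  cases x <;> cases y <;> simp_all [perm, (GalvinVertex.perm_injective σ τ).eq_iff]

theorem brSum_perm (ρ : Equiv.Perm (Fin m)) (σ : Equiv.Perm (Fin 3)) (τ : Equiv.Perm (Fin t))
    (w : BRVertex m t → Bool → ℕ) : brSum m t (fun x => w (perm ρ σ τ x)) = brSum m t w := by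
  refine Finset.sum_congr rfl fun b _ => congrArg _ ?_
  exact Fintype.prod_equiv ρ _ _ fun i =>
    GalvinVertex.galvinSum_perm σ τ _ fun x => w (copy (ρ i) x)

/-- The copy in which a vertex lies. -/
def copyIndex : BRVertex (m + 1) t → Fin (m + 1)
  | root => 0
  | leaf => 0
  | copy i _ => i

/-- The place of a vertex inside its copy. -/
def place : BRVertex m t → GalvinVertex 3 t
  | root => .root
  | leaf => .root
  | copy _ x => x

/-- The vertices of the first arm of the first branch of the first copy, with the root and the
extra leaf. -/
def firstArm (m t : ℕ) : List (BRVertex (m + 2) (t + 2)) :=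
  root :: leaf :: (GalvinVertex.firstArm 1 t).map (copy 0)

/-- The vertices of the first two arms of the first two branches of the first two copies, with the
root and the extra leaf. -/
def firstArms (m t : ℕ) : List (BRVertex (m + 2) (t + 2)) :=
  root :: leaf :: ((GalvinVertex.firstArms 1 t).map (copy 0) ++
    (GalvinVertex.firstArms 1 t).map (copy 1))

/-- The weighted sum over all copies for a weight that is uniform outside `firstArms`, where `b`
tells whether the root is chosen. -/
def copiesSumOfUniform (B : ℕ) (w : BRVertex (m + 2) (t + 2) → Bool → ℕ) (b : Bool) : ℕ :=
  GalvinVertex.galvinSumOfUniform (m := 1) B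
      (fun c => edgeWeight b c * w (copy 0 .root) c) (fun x => w (copy 0 x)) *
    GalvinVertex.galvinSumOfUniform (m := 1) B
      (fun c => edgeWeight b c * w (copy 1 .root) c) (fun x => w (copy 1 x)) *
    GalvinVertex.galvinSumOfUniform (m := 1) (t := t) B
      (fun c => edgeWeight b c * bif c then B else 1) (uniformWeight B) ^ m

/-- The value of `brSum` for a weight that is uniform outside `firstArms`. -/
def brSumOfUniform (B : ℕ) (w : BRVertex (m + 2) (t + 2) → Bool → ℕ) : ℕ :=
  w root true * w leaf false * copiesSumOfUniform B w true +
    w root false * (w leaf true + w leaf false) * copiesSumOfUniform B w false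

theorem brSum_eq_brSumOfUniform {B : ℕ} {w : BRVertex (m + 2) (t + 2) → Bool → ℕ}
    (hw : ∀ x ∉ firstArms m t, w x = uniformWeight B x) :
    brSum (m + 2) (t + 2) w = brSumOfUniform B w := by
  have hsum : brSumOfUniform B w =
      ∑ b, w root b * (∑ c, edgeWeight b c * w leaf c) * copiesSumOfUniform B w b := by
    simp [brSumOfUniform, edgeWeight]
  rw [hsum]
  refine Finset.sum_congr rfl fun b _ => congrArg _ ?_
  rw [copiesSumOfUniform, prod_fin_add_two fun i => ?_]
  · rw [GalvinVertex.galvinSum_eq_galvinSumOfUniform (m := 1) (B := B),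
      GalvinVertex.galvinSum_eq_galvinSumOfUniform (m := 1) (B := B)]
    · intro x hx
      rw [hw _ (by simpa [firstArms] using hx)]
      rfl
    · intro x hx
      rw [hw _ (by simpa [firstArms] using hx)]
      rfl
  · have hcopy : ∀ x, w (copy i.succ.succ x) = uniformWeight B (copy i.succ.succ x) :=
      fun x => hw _ (by simp [firstArms, Fin.ext_iff])
    simp only [hcopy]
    exact GalvinVertex.galvinSum_eq_galvinSumOfUniform (m := 1) (fun _ _ => rfl) _

/-- The digit check for the pairs of vertices in the first two arms of the first two branches of the
first two copies. -/
def pairsCheck (B n m t : ℕ) : Bool :=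
  (firstArm m t).all fun u => (firstArms m t).all fun v => beq u v || digitCheck B n
    (brSumOfUniform (m := m) (t := t) B (uniformWeight B) - brSumOfUniform B (forcedWeight B u v))

theorem universalEnlargement_brTree {B n : ℕ}
    (hB : 2 ^ ((m + 2) * (6 * (t + 2) + 4) + 1 + 1) < B)
    (h : pairsCheck B n m t = true) :
    UniversalEnlargement (brTree (m + 2) (t + 2)) := by
  refine universalEnlargement_of_digitCheck (B := B) (n := n) (isTree _ _) (by rwa [card_eq]) ?_
  intro u v huv
  obtain ⟨ρ, hρu, hρv⟩ := exists_perm_apply_eq_zero u.copyIndex v.copyIndex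
  -- Each copy has 3 = 1 + 2 branches, hence the value 1 here and below.
  obtain ⟨σ, hσu, hσv⟩ := exists_perm_apply_eq_zero (n := 1) u.place.branch v.place.branch
  obtain ⟨τ, hτu, hτv⟩ := exists_perm_apply_eq_zero u.place.arm v.place.arm
  have hinj := perm_injective ρ σ τ
  have hu : perm ρ σ τ u ∈ firstArm m t := by
    have := GalvinVertex.perm_mem_firstArm (m := 1) hσu hτu
    cases u <;> simp_all [perm, firstArm, copyIndex, place]
  have hv : perm ρ σ τ v ∈ firstArms m t := by
    have := GalvinVertex.perm_mem_firstArms (m := 1) hσv hτv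
    rcases hρv with hρv | hρv <;> cases v <;> simp_all [perm, firstArms, copyIndex, place]
  have hsub : firstArm m t ⊆ firstArms m t := by
    simp [firstArm, firstArms, GalvinVertex.firstArm, GalvinVertex.firstArms]
  simp only [pairsCheck, List.all_eq_true, Bool.or_eq_true, beq_eq_true_iff] at h
  have := (h _ hu _ hv).resolve_left (hinj.ne huv)
  rw [← brSum_eq_brSumOfUniform fun _ _ => rfl,
    ← brSum_eq_brSumOfUniform fun x hx => forcedWeight_eq_uniformWeight B
      (fun h => hx (h ▸ hsub hu)) (fun h => hx (h ▸ hv))] at this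
  rw [← brSum_perm ρ σ τ (forcedWeight B _ _)] at this
  simp only [forcedWeight_map B hinj] at this
  rwa [indepSum_brTree, indepSum_brTree]

end BRVertex

end Symmetry

/-! ### Kernel evaluation for the listed parameters, and the count of pairs. -/

set_option maxHeartbeats 4000000 in
theorem universalEnlargement_galvinTree_of_mem {p : ℕ × ℕ} (hp : p ∈ galvinParams) :
    UniversalEnlargement (galvinTree p.1 p.2) := by
  have hle : ∀ p ∈ galvinParams, 2 ≤ p.1 ∧ 2 ≤ p.2 := by decide
  have hB : ∀ p ∈ galvinParams,
      2 ^ ((p.1 - 2 + 2) + 2 * ((p.1 - 2 + 2) * (p.2 - 2 + 2)) + 1) < 2 ^ 192 := by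
    decide +kernel
  -- The independence number of T_{m,t} is m(t+1), attained by all tips and children, so m(t+1) + 1
  -- digits suffice.
  have hcheck : ∀ p ∈ galvinParams, GalvinVertex.pairsCheck (2 ^ 192) (p.1 * (p.2 + 1) + 1)
      (p.1 - 2) (p.2 - 2) = true := by
    decide +kernel
  have h := GalvinVertex.universalEnlargement_galvinTree (hB p hp) (hcheck p hp)
  rwa [Nat.sub_add_cancel (hle p hp).1, Nat.sub_add_cancel (hle p hp).2] at h

set_option maxHeartbeats 4000000 in
theorem universalEnlargement_brTree_of_mem {p : ℕ × ℕ} (hp : p ∈ brParams) :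
    UniversalEnlargement (brTree p.1 p.2) := by
  have hle : ∀ p ∈ brParams, 2 ≤ p.1 ∧ 2 ≤ p.2 := by decide
  -- The largest tree in the family, T_{G,3,8}, has 158 vertices, so the base 2^192 is large enough
  -- throughout.
  have hB : ∀ p ∈ brParams,
      2 ^ ((p.1 - 2 + 2) * (6 * (p.2 - 2 + 2) + 4) + 1 + 1) < 2 ^ 192 := by
    decide +kernel
  -- Each copy contributes 3t + 3 to the independence number and the extra leaf one more; the
  -- constant coefficient accounts for the other 1.
  have hcheck : ∀ p ∈ brParams, BRVertex.pairsCheck (2 ^ 192) (p.1 * (3 * p.2 + 3) + 2)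
      (p.1 - 2) (p.2 - 2) = true := by
    decide +kernel
  have h := BRVertex.universalEnlargement_brTree (hB p hp) (hcheck p hp)
  rwa [Nat.sub_add_cancel (hle p hp).1, Nat.sub_add_cancel (hle p hp).2] at h

theorem mainTheorem8 :
    (∀ p ∈ galvinParams, UniversalEnlargement (galvinTree p.1 p.2)) ∧
    (∀ p ∈ brParams, UniversalEnlargement (brTree p.1 p.2)) ∧
    (∑ p ∈ galvinParams, (galvinTree p.1 p.2)ᶜ.edgeSet.ncard) +
      (∑ p ∈ brParams, (brTree p.1 p.2)ᶜ.edgeSet.ncard) = 66303 := by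
  refine ⟨fun p hp => universalEnlargement_galvinTree_of_mem hp,
    fun p hp => universalEnlargement_brTree_of_mem hp, ?_⟩
  have hG : ∀ p : ℕ × ℕ, (galvinTree p.1 p.2)ᶜ.edgeSet.ncard =
      (p.1 + 2 * (p.1 * p.2) + 1).choose 2 - (p.1 + 2 * (p.1 * p.2)) := fun p =>
    (GalvinVertex.isTree p.1 p.2).ncard_compl_edgeSet
      (Nat.card_eq_fintype_card.trans (GalvinVertex.card_eq p.1 p.2))
  have hBR : ∀ p : ℕ × ℕ, (brTree p.1 p.2)ᶜ.edgeSet.ncard =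
      (p.1 * (6 * p.2 + 4) + 1 + 1).choose 2 - (p.1 * (6 * p.2 + 4) + 1) := fun p =>
    (BRVertex.isTree p.1 p.2).ncard_compl_edgeSet
      (Nat.card_eq_fintype_card.trans (BRVertex.card_eq p.1 p.2))
  simp only [hG, hBR, Nat.choose_two_right]
  decide +kernel
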